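/- Let $d$ be a natural number. For $y\in\mathbb{R}^d$ and $f\in L^2(\mathbb{R}^d)$ (complex-valued functions, Lebesgue measure) let $t_yf(x)=f(x-y)$, and let $\widehat f$ denote the Fourier transform of $f$, i.e. the unitary extension to $L^2(\mathbb{R}^d)$ of $\widehat f(\omega)=\int_{\mathbb{R}^d}f(x)\,e^{-2\pi i\langle\omega,x\rangle}\,dx$. For $\varphi\in L^2(\mathbb{R}^d)$ let $S(\varphi)=\overline{\operatorname{span}}\{t_k\varphi : k\in\mathbb{Z}^d\}$, the closure being taken in $L^2(\mathbb{R}^d)$. If $\varphi\in L^2(\mathbb{R}^d)$ and $S(\varphi)$ is $\mathbb{R}^d$-invariant, i.e. $t_xf\in S(\varphi)$ for all $x\in\mathbb{R}^d$ and all $f\in S(\varphi)$, then $$\bigl|\{\omega\in\mathbb{R}^d : \widehat\varphi(\omega)\neq 0\}\bigr|\le 1,$$ where $|\cdot|$ denotes Lebesgue measure. (The set is determined up to a null set.) -/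

import Mathlib

open MeasureTheory
open scoped FourierTransform ENNReal

noncomputable section

/-- The Hilbert space `L²(ℝ^d)` of complex-valued functions, with respect to Lebesgue measure. -/
abbrev L2 (d : ℕ) : Type :=
  Lp (α := EuclideanSpace ℝ (Fin d)) ℂ 2 volume

/-- The translation operator `(t_y f)(x) = f (x - y)` on `L²(ℝ^d)`. -/
def translation {d : ℕ} (y : EuclideanSpace ℝ (Fin d)) : L2 d →ₗᵢ[ℂ] L2 d :=
  Lp.compMeasurePreservingₗᵢ ℂ (fun x : EuclideanSpace ℝ (Fin d) => x - y)
    (measurePreserving_sub_right volume y)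

/-- A vector of integers, as a point of `ℝ^d`. -/
def intPoint {d : ℕ} (k : Fin d → ℤ) : EuclideanSpace ℝ (Fin d) :=
  WithLp.toLp 2 (fun i => (k i : ℝ))

/-- The shift-invariant space `S(Φ)` generated by `Φ ⊆ L²(ℝ^d)`: the closed linear span of
all integer translates of elements of `Φ`. -/
def shiftInvariantSpan {d : ℕ} (Φ : Set (L2 d)) : Submodule ℂ (L2 d) :=
  (Submodule.span ℂ
    {g : L2 d | ∃ φ ∈ Φ, ∃ k : Fin d → ℤ, g = translation (intPoint k) φ}).topologicalClosure

/-- A subspace `S` of `L²(ℝ^d)` is `M`-invariant if `t_m f ∈ S` for all `m ∈ M` and `f ∈ S`. -/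
def IsTranslationInvariant {d : ℕ} (M : AddSubgroup (EuclideanSpace ℝ (Fin d)))
    (S : Submodule ℂ (L2 d)) : Prop :=
  ∀ m ∈ M, ∀ f ∈ S, translation m f ∈ S

end

open scoped SchwartzMap RealInnerProductSpace

variable {d : ℕ}

/-! On the Fourier side `t_y` is multiplication by the character `e(-⟪y, ω⟫)`, which is
`ℤ^d`-periodic when `y` is integral. Hence the ratio `f̂ / φ̂` is formally periodic for `f ∈ S(φ)`:
the cross-multiplied difference `fourierWronskian k φ f` vanishes for integral `k`. Real translates
of `φ` also lie in `S(φ)`, and for them this reads `(1 - e(⟪y, k⟫)) φ̂(ω) φ̂(ω - k) = 0` up to a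
unimodular factor. For `k ≠ 0` some `y` makes the first factor nonzero, so the support of `φ̂` is
a.e. disjoint from its nonzero integer translates and has at most the volume of a unit cube. -/

theorem coeFn_translation (y : EuclideanSpace ℝ (Fin d)) (f : L2 d) :
    (translation y f : EuclideanSpace ℝ (Fin d) → ℂ) =ᵐ[volume] fun x => f (x - y) :=
  Lp.coeFn_compMeasurePreserving f (measurePreserving_sub_right volume y)

/-- The character `ω ↦ exp (-2πi⟪y, ω⟫)` as an element of `L^∞`. -/
noncomputable def modulationSymbol (y : EuclideanSpace ℝ (Fin d)) :
    Lp (α := EuclideanSpace ℝ (Fin d)) ℂ ∞ volume :=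
  (memLp_top_of_bound (f := fun ω : EuclideanSpace ℝ (Fin d) => (Real.fourierChar (-⟪y, ω⟫) : ℂ))
    (by fun_prop) 1 (.of_forall fun _ => (Circle.norm_coe _).le)).toLp

theorem coeFn_modulationSymbol (y : EuclideanSpace ℝ (Fin d)) :
    (modulationSymbol y : EuclideanSpace ℝ (Fin d) → ℂ)
      =ᵐ[volume] fun ω => (Real.fourierChar (-⟪y, ω⟫) : ℂ) :=
  MemLp.coeFn_toLp _

theorem fourier_compSubConst_apply (y : EuclideanSpace ℝ (Fin d))
    (f : 𝓢(EuclideanSpace ℝ (Fin d), ℂ)) (ω : EuclideanSpace ℝ (Fin d)) :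
    𝓕 (f.compSubConstCLM ℂ y) ω = Real.fourierChar (-⟪y, ω⟫) * 𝓕 f ω := by
  have h := congrFun (VectorFourier.fourierIntegral_comp_add_right Real.fourierChar
    (volume : Measure (EuclideanSpace ℝ (Fin d))) (innerₗ _) f (-y)) ω
  simp only [innerₗ_apply_apply, inner_neg_left] at h
  exact h

theorem translation_toLp (y : EuclideanSpace ℝ (Fin d))
    (f : 𝓢(EuclideanSpace ℝ (Fin d), ℂ)) :
    translation y (f.toLp 2) = (f.compSubConstCLM ℂ y).toLp 2 :=
  rfl

/-- Both sides are continuous in `f`, so the pointwise formula for Schwartz functions extends by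
density. -/
theorem fourier_translation (y : EuclideanSpace ℝ (Fin d)) (f : L2 d) :
    (𝓕 (translation y f) : L2 d) =
      (ContinuousLinearMap.mul ℂ ℂ).holderL volume ∞ 2 2 (modulationSymbol y) (𝓕 f : L2 d) := by
  refine DenseRange.induction_on
    (SchwartzMap.denseRange_toLpCLM (p := 2) ENNReal.ofNat_ne_top) f
    (p := fun f : L2 d => (𝓕 (translation y f) : L2 d) =
      (ContinuousLinearMap.mul ℂ ℂ).holderL volume ∞ 2 2 (modulationSymbol y) (𝓕 f : L2 d)) ?_ ?_
  · refine isClosed_eq ?_ ?_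
    · exact (Lp.fourierTransformₗᵢ _ ℂ).continuous.comp (translation y).continuous
    · exact (ContinuousLinearMap.continuous _).comp (Lp.fourierTransformₗᵢ _ ℂ).continuous
  · intro g
    simp only [SchwartzMap.toLpCLM_apply]
    rw [translation_toLp, SchwartzMap.toLp_fourier_eq, SchwartzMap.toLp_fourier_eq,
      ContinuousLinearMap.holderL_apply_apply]
    apply Lp.ext
    filter_upwards [SchwartzMap.coeFn_toLp (𝓕 (g.compSubConstCLM ℂ y)) 2 volume,
      SchwartzMap.coeFn_toLp (𝓕 g) 2 volume, coeFn_modulationSymbol y,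
      ContinuousLinearMap.coeFn_holder (r := 2) (ContinuousLinearMap.mul ℂ ℂ) (modulationSymbol y)
        ((𝓕 g).toLp 2 volume)] with ω h₁ h₂ h₃ h₄
    rw [h₁, h₄, h₂, h₃, fourier_compSubConst_apply, ContinuousLinearMap.mul_apply']

theorem coeFn_fourier_translation (y : EuclideanSpace ℝ (Fin d)) (f : L2 d) :
    ((𝓕 (translation y f) : L2 d) : EuclideanSpace ℝ (Fin d) → ℂ) =ᵐ[volume]
      fun ω => Real.fourierChar (-⟪y, ω⟫) * (𝓕 f : L2 d) ω := by
  rw [fourier_translation, ContinuousLinearMap.holderL_apply_apply]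
  filter_upwards [coeFn_modulationSymbol y,
    ContinuousLinearMap.coeFn_holder (r := 2) (ContinuousLinearMap.mul ℂ ℂ) (modulationSymbol y)
      (𝓕 f : L2 d)] with ω h₁ h₂
  rw [h₂, h₁, ContinuousLinearMap.mul_apply']

/-- The `L¹` function `ω ↦ f̂ ω * φ̂ (ω - n) - f̂ (ω - n) * φ̂ ω`, as a function of `f`. -/
noncomputable def fourierWronskian (n : EuclideanSpace ℝ (Fin d)) (φ : L2 d) :
    L2 d →L[ℂ] Lp (α := EuclideanSpace ℝ (Fin d)) ℂ 1 volume :=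
  (((ContinuousLinearMap.mul ℂ ℂ).holderL volume 2 2 1).flip (translation n (𝓕 φ : L2 d)) -
    (((ContinuousLinearMap.mul ℂ ℂ).holderL volume 2 2 1).flip (𝓕 φ : L2 d)).comp
      (translation n).toContinuousLinearMap).comp
    (Lp.fourierTransformₗᵢ (EuclideanSpace ℝ (Fin d)) ℂ :
      L2 d ≃ₗᵢ[ℂ] L2 d).toContinuousLinearEquiv.toContinuousLinearMap

theorem coeFn_fourierWronskian (n : EuclideanSpace ℝ (Fin d)) (φ f : L2 d) :
    (fourierWronskian n φ f : EuclideanSpace ℝ (Fin d) → ℂ) =ᵐ[volume]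
      fun ω => (𝓕 f : L2 d) ω * (𝓕 φ : L2 d) (ω - n) -
        (𝓕 f : L2 d) (ω - n) * (𝓕 φ : L2 d) ω := by
  have h : fourierWronskian n φ f =
      (ContinuousLinearMap.mul ℂ ℂ).holder 1 (𝓕 f : L2 d) (translation n (𝓕 φ : L2 d)) -
      (ContinuousLinearMap.mul ℂ ℂ).holder 1 (translation n (𝓕 f : L2 d)) (𝓕 φ : L2 d) := rfl
  rw [h]
  filter_upwards [Lp.coeFn_sub
    ((ContinuousLinearMap.mul ℂ ℂ).holder 1 (𝓕 f : L2 d) (translation n (𝓕 φ : L2 d)))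
    ((ContinuousLinearMap.mul ℂ ℂ).holder 1 (translation n (𝓕 f : L2 d)) (𝓕 φ : L2 d)),
    ContinuousLinearMap.coeFn_holder (r := 1) (ContinuousLinearMap.mul ℂ ℂ)
      (𝓕 f : L2 d) (translation n (𝓕 φ : L2 d)),
    ContinuousLinearMap.coeFn_holder (r := 1) (ContinuousLinearMap.mul ℂ ℂ)
      (translation n (𝓕 f : L2 d)) (𝓕 φ : L2 d),
    coeFn_translation n (𝓕 φ : L2 d), coeFn_translation n (𝓕 f : L2 d)] with ω h₁ h₂ h₃ h₄ h₅
  rw [h₁, Pi.sub_apply, h₂, h₃, h₄, h₅, ContinuousLinearMap.mul_apply',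
    ContinuousLinearMap.mul_apply']

theorem inner_intPoint (k l : Fin d → ℤ) :
    ⟪intPoint k, intPoint l⟫ = ((∑ i, k i * l i : ℤ) : ℝ) := by
  simp [intPoint, PiLp.inner_apply, mul_comm]

theorem fourierChar_intCast (m : ℤ) : (Real.fourierChar (m : ℝ) : ℂ) = 1 := by
  rw [Real.fourierChar_apply, Complex.exp_eq_one_iff]
  exact ⟨m, by push_cast; ring⟩

theorem ae_comp_sub {p : EuclideanSpace ℝ (Fin d) → Prop} (h : ∀ᵐ ω, p ω)
    (n : EuclideanSpace ℝ (Fin d)) : ∀ᵐ ω, p (ω - n) :=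
  (measurePreserving_sub_right volume n).quasiMeasurePreserving.ae h

theorem coeFn_fourierWronskian_translation (n y : EuclideanSpace ℝ (Fin d)) (φ : L2 d) :
    (fourierWronskian n φ (translation y φ) : EuclideanSpace ℝ (Fin d) → ℂ) =ᵐ[volume]
      fun ω => (1 - Real.fourierChar ⟪y, n⟫) * (Real.fourierChar (-⟪y, ω⟫) *
        ((𝓕 φ : L2 d) ω * (𝓕 φ : L2 d) (ω - n))) := by
  filter_upwards [coeFn_fourierWronskian n φ (translation y φ), coeFn_fourier_translation y φ,
    ae_comp_sub (coeFn_fourier_translation y φ) n] with ω h₁ h₂ h₃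
  have h : (Real.fourierChar (-⟪y, ω - n⟫) : ℂ) =
      Real.fourierChar (-⟪y, ω⟫) * Real.fourierChar ⟪y, n⟫ := by
    rw [← Circle.coe_mul, ← AddChar.map_add_eq_mul, inner_sub_right]
    congr 3
    ring
  rw [h₁, h₂, h₃, h]
  ring

/-- Continuity from `L²` to `L¹` makes the kernel closed, so integer translates of `φ` suffice; for
these `⟪l, k⟫ ∈ ℤ` and the factor `1 - e(⟪l, k⟫)` is zero. -/
theorem fourierWronskian_eq_zero_of_mem (k : Fin d → ℤ) {φ f : L2 d}
    (hf : f ∈ shiftInvariantSpan {φ}) : fourierWronskian (intPoint k) φ f = 0 := by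
  refine Submodule.topologicalClosure_minimal
    (t := LinearMap.ker (fourierWronskian (intPoint k) φ).toLinearMap) _ ?_
    (ContinuousLinearMap.isClosed_ker _) hf
  rw [Submodule.span_le]
  rintro _ ⟨ψ, hψ, l, rfl⟩
  rw [Set.mem_singleton_iff.1 hψ]
  refine Lp.ext ?_
  filter_upwards [coeFn_fourierWronskian_translation (intPoint k) (intPoint l) φ,
    Lp.coeFn_zero ℂ 1 volume] with ω h₁ h₂
  rw [h₂]
  refine h₁.trans ?_
  rw [inner_intPoint, fourierChar_intCast]
  simp

theorem exists_fourierChar_inner_ne_one {n : EuclideanSpace ℝ (Fin d)} (hn : n ≠ 0) :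
    ∃ y : EuclideanSpace ℝ (Fin d), (Real.fourierChar ⟪y, n⟫ : ℂ) ≠ 1 := by
  -- Scaled so that `⟪y, n⟫ = 1/2`, where the character equals `-1`.
  refine ⟨(2 * ‖n‖ ^ 2)⁻¹ • n, ?_⟩
  have h : ⟪(2 * ‖n‖ ^ 2)⁻¹ • n, n⟫ = (1 / 2 : ℝ) := by
    have : ‖n‖ ≠ 0 := norm_ne_zero_iff.2 hn
    rw [real_inner_smul_left, real_inner_self_eq_norm_sq]
    field_simp
  rw [h, Real.fourierChar_apply]
  have : ((2 * Real.pi * (1 / 2) : ℝ) : ℂ) = Real.pi := by push_cast; ring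
  rw [this, Complex.exp_pi_mul_I]
  norm_num

theorem fourier_mul_fourier_sub_ae_eq_zero {φ : L2 d}
    (hφ : IsTranslationInvariant (⊤ : AddSubgroup (EuclideanSpace ℝ (Fin d)))
      (shiftInvariantSpan {φ})) {k : Fin d → ℤ} (hk : intPoint k ≠ 0) :
    ∀ᵐ ω, (𝓕 φ : L2 d) ω * (𝓕 φ : L2 d) (ω - intPoint k) = 0 := by
  have hmem : φ ∈ shiftInvariantSpan {φ} := by
    refine Submodule.le_topologicalClosure _ (Submodule.subset_span ⟨φ, rfl, 0, ?_⟩)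
    refine Lp.ext ?_
    filter_upwards [coeFn_translation (intPoint 0) φ] with x hx
    have h0 : intPoint (0 : Fin d → ℤ) = 0 := by ext; simp [intPoint]
    rw [hx, h0, sub_zero]
  obtain ⟨y, hy⟩ := exists_fourierChar_inner_ne_one hk
  have h := coeFn_fourierWronskian_translation (intPoint k) y φ
  rw [fourierWronskian_eq_zero_of_mem k (hφ y trivial φ hmem)] at h
  filter_upwards [h, Lp.coeFn_zero ℂ 1 volume] with ω h₁ h₂
  have h₃ := h₁.symm.trans h₂
  simpa [sub_eq_zero, hy.symm] using h₃

theorem exists_intPoint_of_mem_span {v : EuclideanSpace ℝ (Fin d)}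
    (hv : v ∈ Submodule.span ℤ (Set.range (EuclideanSpace.basisFun (Fin d) ℝ).toBasis)) :
    ∃ k : Fin d → ℤ, v = intPoint k := by
  rw [Module.Basis.mem_span_iff_repr_mem] at hv
  choose k hk using hv
  refine ⟨k, ?_⟩
  ext i
  simpa [intPoint] using (hk i).symm

theorem volume_fundamentalDomain_basisFun :
    volume (ZSpan.fundamentalDomain (EuclideanSpace.basisFun (Fin d) ℝ).toBasis) = 1 := by
  rw [measure_congr (ZSpan.fundamentalDomain_ae_parallelepiped _ volume)]
  simpa using (EuclideanSpace.basisFun (Fin d) ℝ).volume_parallelepiped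

/-- A set with a.e. disjoint lattice translates is no larger than a fundamental domain, here the
unit cube. -/
theorem volume_le_one_of_aedisjoint_intPoint {s : Set (EuclideanSpace ℝ (Fin d))}
    (hs : NullMeasurableSet s)
    (h : ∀ k : Fin d → ℤ, intPoint k ≠ 0 → ∀ᵐ ω, ω ∈ s → ω - intPoint k ∉ s) :
    volume s ≤ 1 := by
  set b := (EuclideanSpace.basisFun (Fin d) ℝ).toBasis
  rw [← volume_fundamentalDomain_basisFun (d := d)]
  have : VAddInvariantMeasure (Submodule.span ℤ (Set.range b)) (EuclideanSpace ℝ (Fin d)) volume :=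
    inferInstanceAs <|
      VAddInvariantMeasure (Submodule.span ℤ (Set.range b)).toAddSubgroup _ volume
  refine (ZSpan.isAddFundamentalDomain b volume).measure_le_of_pairwise_disjoint hs ?_
  intro u v huv
  refine AEDisjoint.mono ?_ Set.inter_subset_left Set.inter_subset_left
  obtain ⟨k, hk⟩ := exists_intPoint_of_mem_span (v - u).2
  have hk' : (v : EuclideanSpace ℝ (Fin d)) - u = intPoint k := hk
  have hk0 : intPoint k ≠ 0 := by
    rw [← hk', sub_ne_zero]
    exact fun h => huv (Subtype.ext h.symm)
  -- A common point `x = u + a = v + c` with `a, c ∈ s` gives `x - u = a` and `a - k = c`, so `x -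
  -- u` lies in the null set excluded by `h`.
  refine measure_mono_null ?_ (ae_iff.1 (ae_comp_sub (h k hk0) u))
  rintro x ⟨⟨a, ha, rfl⟩, ⟨c, hc, hac⟩⟩ hx
  have hac' : (v : EuclideanSpace ℝ (Fin d)) + c = u + a := hac
  have e₁ : (u +ᵥ a : EuclideanSpace ℝ (Fin d)) - u = a :=
    add_sub_cancel_left (u : EuclideanSpace ℝ (Fin d)) a
  have e₂ : a - intPoint k = c := by
    rw [← hk', sub_eq_iff_eq_add, add_sub, add_comm c, hac', add_sub_cancel_left]
  simp only [e₁, e₂] at hx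
  exact hx ha hc

theorem corollary5p4 (d : ℕ) (φ : L2 d)
    (hφ : IsTranslationInvariant (⊤ : AddSubgroup (EuclideanSpace ℝ (Fin d)))
      (shiftInvariantSpan {φ})) :
    volume (Function.support (𝓕 φ : L2 d)) ≤ 1 := by
  refine volume_le_one_of_aedisjoint_intPoint
    (Lp.stronglyMeasurable (𝓕 φ : L2 d)).measurableSet_support.nullMeasurableSet fun k hk => ?_
  filter_upwards [fourier_mul_fourier_sub_ae_eq_zero hφ hk] with ω h h₁ h₂
  exact mul_ne_zero h₁ h₂ h
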